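/- Let $K$ be an algebraically closed field of characteristic zero (for instance $K=\mathbb{C}$). For an integral variety $X$ over $K$ of dimension $n$, a \emph{pseudo-chart} of $X$ is a morphism of $K$-varieties $f:\mathbb{A}^n\to X$ with $\dim f(\mathbb{A}^n)=n$; its \emph{degree} is the degree $[K(\mathbb{A}^n):K(X)]$ of the extension of function fields induced by $f$. Then: (i) for every integer $n\ge 1$, $\mathbb{P}^n$ has a surjective, flat pseudo-chart $\mathbb{A}^n\to\mathbb{P}^n$ with finite fibers, of degree $n!\,2^{n}$; (ii) for every integer $n\ge 2$, $\mathbb{P}^n$ has a surjective, flat pseudo-chart $\mathbb{A}^n\to\mathbb{P}^n$ with finite fibers, of degree $n!\,2^{n-1}$. -/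

import Mathlib

open CategoryTheory AlgebraicGeometry

universe u

noncomputable section

namespace PseudoChart

attribute [local instance] MvPolynomial.gradedAlgebra

/-- Affine `n`-space `𝔸ⁿ` over the field `K`, as a scheme over `Spec K`. -/
abbrev affineSpace (K : Type u) [Field K] (n : ℕ) : Scheme.{u} :=
  𝔸(ULift.{u} (Fin n); Spec (.of K))

instance affineSpace_isIntegral (K : Type u) [Field K] (n : ℕ) :
    IsIntegral (affineSpace K n) :=
  have : IsIntegral (Spec (.of (MvPolynomial (ULift.{u} (Fin n)) K))) := inferInstance
  isIntegral_of_isOpenImmersion (AffineSpace.SpecIso (ULift.{u} (Fin n)) (.of K)).hom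

/-- Projective `n`-space `ℙⁿ` over the field `K`: the scheme `Proj K[x₀, …, xₙ]`, for the grading
by total degree. -/
def projectiveSpace (K : Type u) [Field K] (n : ℕ) : Scheme.{u} :=
  Proj (MvPolynomial.homogeneousSubmodule (Fin (n + 1)) K)

/-- The structure morphism `ℙⁿ ⟶ Spec K[x₀, …, xₙ]₀ ⟶ Spec K`. -/
instance projectiveSpace_over (K : Type u) [Field K] (n : ℕ) :
    (projectiveSpace K n).CanonicallyOver (Spec (.of K)) where
  hom := Proj.toSpecZero (MvPolynomial.homogeneousSubmodule (Fin (n + 1)) K) ≫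
    Spec.map (CommRingCat.ofHom
      (algebraMap K (MvPolynomial.homogeneousSubmodule (Fin (n + 1)) K 0)))

/-- A dominant morphism of irreducible schemes maps the generic point to the generic point. -/
theorem map_genericPoint {X Y : Scheme.{u}} [IrreducibleSpace X] [IrreducibleSpace Y]
    (f : X ⟶ Y) [IsDominant f] : f (genericPoint X) = genericPoint Y := by
  refine IsGenericPoint.eq ?_ (genericPoint_spec Y)
  have h := (genericPoint_spec X).image f.continuous
  rwa [Set.image_univ, f.denseRange.closure_range] at h

/-- The degree of a dominant morphism `f : X ⟶ Y` of integral schemes: the degree `[K(X) : K(Y)]`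
of the extension of function fields given by the map that `f` induces on the local rings at the
generic points (`f` maps the generic point of `X` to that of `Y`, by `map_genericPoint`).
As for `Module.finrank`, the value is `0` if the extension is infinite. -/
def degree {X Y : Scheme.{u}} [IrreducibleSpace X] (f : X ⟶ Y) : ℕ :=
  letI := (f.stalkMap (genericPoint X)).hom.toAlgebra
  Module.finrank (Y.presheaf.stalk (f (genericPoint X))) (X.presheaf.stalk (genericPoint X))

/-- A pseudo-chart of an `n`-dimensional variety `X` over `K` is a morphism of `K`-varieties
`f : 𝔸ⁿ ⟶ X` such that `dim f(𝔸ⁿ) = n`. -/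
structure IsPseudoChart {K : Type u} [Field K] {n : ℕ} {X : Scheme.{u}} [X.Over (Spec (.of K))]
    (f : affineSpace K n ⟶ X) : Prop where
  isIntegral : IsIntegral X
  dim_eq : topologicalKrullDim X = n
  isOver : f.IsOver (Spec (.of K))
  dim_range : topologicalKrullDim (Set.range f) = n

/-- The fibers of `f` (over all points, closed or not) are finite sets. -/
def HasFiniteFibers {X Y : Scheme.{u}} (f : X ⟶ Y) : Prop :=
  ∀ y : Y, (f ⁻¹' {y}).Finite

end PseudoChart

end

/-! Identify 𝔸ⁿ with the hyperplane ∑ xᵢ = 1 in 𝔸ⁿ⁺¹, that is, with the complement in ℙⁿ of H : ∑ xᵢ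
= 0. Then `squareMap` is the restriction to this complement of coordinatewise squaring ℙⁿ ⟶ ℙⁿ.
Squaring is finite and flat of degree 2ⁿ, so the restriction is flat and quasi-finite of the same
degree. It is still surjective: sign changes of the coordinates preserve the fibers of squaring, and
no fiber lies inside H, for if 1 + ∑ zⱼ = 0 in a chart, then 1 - ∑ zⱼ = 2 ≠ 0.

Precomposing with t₁ ↦ t₁ᵐ, which is finite, flat and surjective of degree m, multiplies the degree
by m. Take m = n! for (i) and m = n!/2 for (ii).

The main lemmas are `exists_squareMap_morphismRestrict_eq` (the map in a chart),
`exists_comap_powHom_eq_notMem` (surjectivity), `powBasis` (power maps are free of rank ∏ dᵢ) and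
`degree_comp`. -/

noncomputable section

namespace PseudoChart

open MvPolynomial HomogeneousLocalization

attribute [local instance] MvPolynomial.gradedAlgebra

/-! ### Power maps of polynomial rings are free of finite rank -/

section PowerMap

variable {σ : Type*} (R : Type*) [CommRing R] (d : σ → ℕ)

/-- The endomorphism `X i ↦ X i ^ d i` of a polynomial ring. -/
def powHom : MvPolynomial σ R →ₐ[R] MvPolynomial σ R :=
  aeval fun i ↦ X i ^ d i

@[simp]
lemma powHom_X (i : σ) : powHom R d (X i) = X i ^ d i := by simp [powHom]

@[simp]
lemma powHom_C (r : R) : powHom R d (C r) = C r := by simp [powHom]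

variable [Fintype σ]

/-- The exponent vector `d * a + e`, as a finitely supported function. -/
def combine (a : σ →₀ ℕ) (e : ∀ i, Fin (d i)) : σ →₀ ℕ :=
  Finsupp.equivFunOnFinite.symm fun i ↦ d i * a i + e i

@[simp]
lemma combine_apply (a : σ →₀ ℕ) (e : ∀ i, Fin (d i)) (i : σ) :
    combine d a e i = d i * a i + e i := rfl

lemma combine_inj {a a' : σ →₀ ℕ} {e e' : ∀ i, Fin (d i)} :
    combine d a e = combine d a' e' ↔ a = a' ∧ e = e' := by
  refine ⟨fun h ↦ ?_, fun h ↦ by rw [h.1, h.2]⟩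
  have key (i : σ) : a i = a' i ∧ e i = e' i := by
    have h1 := DFunLike.congr_fun h i
    have h2 := congrArg (· / d i) h1
    have h3 := congrArg (· % d i) h1
    -- An element of `Fin (d i)` already forces `0 < d i`.
    have hd := (e i).pos
    simp only [combine_apply, Nat.mul_add_div hd, Nat.div_eq_of_lt (e i).2,
      Nat.div_eq_of_lt (e' i).2, add_zero] at h2
    simp only [combine_apply, Nat.mul_add_mod, Nat.mod_eq_of_lt (e i).2,
      Nat.mod_eq_of_lt (e' i).2] at h3
    exact ⟨h2, Fin.ext h3⟩
  exact ⟨Finsupp.ext fun i ↦ (key i).1, funext fun i ↦ (key i).2⟩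

lemma powHom_monomial_mul (a : σ →₀ ℕ) (r : R) (e : ∀ i, Fin (d i)) :
    powHom R d (monomial a r) * monomial (combine d 0 e) 1 = monomial (combine d a e) r := by
  simp only [powHom, aeval_monomial, ← pow_mul, monomial_eq (s := combine d _ e), algebraMap_eq,
    Finsupp.prod_fintype _ _ (fun i ↦ pow_zero (X i : MvPolynomial σ R)), map_one, one_mul,
    combine_apply, pow_add, Finset.prod_mul_distrib, Finsupp.coe_zero, Pi.zero_apply, mul_zero,
    pow_zero]
  rw [Finsupp.prod_fintype _ _ (fun i ↦ by simp), mul_assoc]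

/-- Division with remainder writes an exponent uniquely as `d * a + e`, so different remainders
never share a monomial. Linear independence in `powBasis` and injectivity of `powHom` both follow by
reading off coefficients. -/
lemma coeff_powHom_mul (p : MvPolynomial σ R) (a : σ →₀ ℕ) (e e' : ∀ i, Fin (d i)) :
    coeff (combine d a e) (powHom R d p * monomial (combine d 0 e') 1) =
      if e' = e then coeff a p else 0 := by
  classical
  induction p using MvPolynomial.induction_on' with
  | monomial b r =>
    rw [powHom_monomial_mul, coeff_monomial, coeff_monomial]
    simp only [combine_inj]
    by_cases h1 : e' = e <;> simp [h1]
  | add p q hp hq =>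
    rw [map_add, add_mul, coeff_add, hp, hq, coeff_add]
    split_ifs <;> simp

/-- The polynomial ring `R[X]`, as an algebra over itself by `X i ↦ X i ^ d i`. -/
def PowCover {σ : Type*} (R : Type*) [CommRing R] (_ : σ → ℕ) : Type _ := MvPolynomial σ R

instance : CommRing (PowCover R d) := inferInstanceAs (CommRing (MvPolynomial σ R))

instance : Algebra (MvPolynomial σ R) (PowCover R d) := (powHom R d).toRingHom.toAlgebra

/-- The monomial with exponents `e`, as an element of `PowCover R d`. -/
def PowCover.monomial (e : ∀ i, Fin (d i)) : PowCover R d :=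
  (MvPolynomial.monomial (combine d 0 e) 1 : MvPolynomial σ R)

/-- The monomials whose exponents are bounded by `d` form a basis of `PowCover R d`. -/
def powBasis (hd : ∀ i, 0 < d i) :
    Module.Basis (∀ i, Fin (d i)) (MvPolynomial σ R) (PowCover R d) :=
  .mk (v := PowCover.monomial R d)
    (by
      classical
      refine Fintype.linearIndependent_iff.mpr ?_
      intro g hg e
      ext a
      have h : coeff (combine d a e) (∑ e', powHom R d (g e') * monomial (combine d 0 e') 1) =
          coeff (combine d a e) 0 := congrArg (fun p : MvPolynomial σ R ↦ coeff _ p) hg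
      rw [coeff_sum, Finset.sum_congr rfl fun e' _ ↦ coeff_powHom_mul R d (g e') a e e'] at h
      simpa using h)
    (by
      rintro (p : MvPolynomial σ R) -
      induction p using MvPolynomial.induction_on' with
      | monomial b r =>
        have h : monomial b r = powHom R d (monomial (Finsupp.equivFunOnFinite.symm
            fun i ↦ b i / d i) r) * monomial (combine d 0 fun i ↦ ⟨b i % d i, Nat.mod_lt _ (hd i)⟩)
              1 := by
          rw [powHom_monomial_mul]
          refine congrArg (MvPolynomial.monomial · r) (Finsupp.ext fun i ↦ ?_)
          simp [Nat.div_add_mod]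
        rw [h]
        exact Submodule.smul_mem _ (monomial _ r) (Submodule.subset_span ⟨_, rfl⟩)
      | add p q hp hq => exact add_mem hp hq)

lemma PowCover.free (hd : ∀ i, 0 < d i) : Module.Free (MvPolynomial σ R) (PowCover R d) :=
  .of_basis (powBasis R d hd)

lemma PowCover.finite (hd : ∀ i, 0 < d i) : Module.Finite (MvPolynomial σ R) (PowCover R d) := by
  classical
  exact .of_basis (powBasis R d hd)

lemma PowCover.finrank [Nontrivial R] (hd : ∀ i, 0 < d i) :
    Module.finrank (MvPolynomial σ R) (PowCover R d) = ∏ i, d i := by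
  classical
  rw [Module.finrank_eq_card_basis (powBasis R d hd)]
  simp

lemma powHom_injective (hd : ∀ i, 0 < d i) : Function.Injective (powHom R d) := by
  rw [injective_iff_map_eq_zero]
  intro p hp
  ext a
  have := coeff_powHom_mul R d p a (fun i ↦ ⟨0, hd i⟩) (fun i ↦ ⟨0, hd i⟩)
  simpa [hp] using this.symm

end PowerMap

lemma isLocalizationAway_of_injective {S T : Type*} [CommRing S] [CommRing T] (f : S →+* T)
    (hf : Function.Injective f) (s : S) (hs : IsUnit (f s))
    (H : ∀ x, ∃ (N : ℕ) (y : S), x * f s ^ N = f y) :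
    letI := f.toAlgebra
    IsLocalization.Away s T := by
  let := f.toAlgebra
  refine IsLocalization.Away.mk s hs (fun x ↦ ?_) (fun a b h ↦ ⟨0, by simpa using hf h⟩)
  obtain ⟨N, y, h⟩ := H x
  exact ⟨N, y, h⟩

/-! ### Coordinates with sum 1, and their ratios in a chart -/

section Barycentric

variable (K : Type*) [CommRing K] (n : ℕ)

/-- The coordinates `1 - ∑ tᵢ, t₁, …, tₙ`, adding up to `1`. -/
def baryCoord : Fin (n + 1) → MvPolynomial (Fin n) K :=
  Fin.cons (1 - ∑ i, X i) X

lemma sum_baryCoord : ∑ i, baryCoord K n i = 1 := by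
  simp [baryCoord, Fin.sum_univ_succ]

variable {K n} {L : Type*} [CommRing L] [Algebra (MvPolynomial (Fin n) K) L] (k : Fin (n + 1))

/-- The homomorphism `zⱼ ↦ xⱼ / xₖ` (`j ≠ k`), where `x` are the coordinates adding up to `1` and
`v` is the inverse of `xₖ`. -/
def ratioHom (v : L) : MvPolynomial (Fin n) K →+* L :=
  eval₂Hom ((algebraMap (MvPolynomial (Fin n) K) L).comp C)
    fun j ↦ algebraMap _ L (baryCoord K n (k.succAbove j)) * v

@[simp]
lemma ratioHom_X (v : L) (j : Fin n) :
    ratioHom k v (X j : MvPolynomial (Fin n) K) =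
      algebraMap _ L (baryCoord K n (k.succAbove j)) * v := by simp [ratioHom]

@[simp]
lemma ratioHom_C (v : L) (r : K) :
    ratioHom k v (C r : MvPolynomial (Fin n) K) = algebraMap (MvPolynomial (Fin n) K) L (C r) := by
  simp [ratioHom]

/-- Divide ∑ xᵢ = 1 by xₖ. -/
lemma ratioHom_one_add_sum {v : L} (hv : algebraMap _ L (baryCoord K n k) * v = 1) :
    ratioHom k v (1 + ∑ j, X j : MvPolynomial (Fin n) K) = v := by
  have h := congrArg (fun p ↦ algebraMap _ L p * v) (sum_baryCoord K n)
  simp only [Fin.sum_univ_succAbove _ k, map_add, map_sum, add_mul, map_one, one_mul, hv,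
    Finset.sum_mul] at h
  simpa using h

lemma exists_mul_pow_eq_ratioHom {v : L} (hv : algebraMap _ L (baryCoord K n k) * v = 1)
    [IsLocalization.Away (baryCoord K n k ^ 2) L] (x : L) :
    ∃ (N : ℕ) (y : MvPolynomial (Fin n) K), x * v ^ N = ratioHom k v y := by
  have hs := ratioHom_one_add_sum k hv
  have coord (i : Fin (n + 1)) : ∃ y : MvPolynomial (Fin n) K,
      algebraMap _ L (baryCoord K n i) * v = ratioHom k v y := by
    rcases Fin.eq_self_or_eq_succAbove k i with rfl | ⟨j, rfl⟩
    · exact ⟨1, by rw [hv, map_one]⟩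
    · exact ⟨X j, by simp⟩
  have poly (p : MvPolynomial (Fin n) K) : ∃ (N : ℕ) (y : MvPolynomial (Fin n) K),
      algebraMap _ L p * v ^ N = ratioHom k v y := by
    induction p using MvPolynomial.induction_on with
    | C r => exact ⟨0, C r, by simp⟩
    | add p q hp hq =>
      obtain ⟨N, y, h⟩ := hp
      obtain ⟨M, z, h'⟩ := hq
      -- Since `1 + ∑ j, X j` maps to `v`, its powers bring both terms to the common exponent `N +
      -- M`.
      refine ⟨N + M, y * (1 + ∑ j, X j) ^ M + z * (1 + ∑ j, X j) ^ N, ?_⟩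
      rw [map_add, map_add, map_mul, map_mul, map_pow, map_pow, hs, ← h, ← h']
      ring
    | mul_X p i hp =>
      obtain ⟨N, y, h⟩ := hp
      obtain ⟨z, hz⟩ := coord i.succ
      refine ⟨N + 1, y * z, ?_⟩
      rw [map_mul, map_mul, ← h, ← hz]
      simp only [baryCoord, Fin.cons_succ]
      ring
  obtain ⟨N, p, h⟩ := IsLocalization.Away.surj (baryCoord K n k ^ 2) x
  obtain ⟨M, y, h'⟩ := poly p
  -- The denominator is (xₖ²)ᴺ, whose inverse is `v ^ (2 * N)`.
  refine ⟨M, y * (1 + ∑ j, X j) ^ (2 * N), ?_⟩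
  rw [map_mul, map_pow, hs, ← h', ← h, map_pow]
  have : (algebraMap _ L (baryCoord K n k) ^ 2) ^ N * v ^ (2 * N) = 1 := by
    rw [← pow_mul, ← mul_pow, hv, one_pow]
  linear_combination (-x * v ^ M) * this

end Barycentric

section BarycentricField

variable {K : Type*} [Field K] {n : ℕ} {L : Type*} [CommRing L]
  [Algebra (MvPolynomial (Fin n) K) L] (k : Fin (n + 1))

lemma one_add_sum_X_ne_zero (σ : Type*) [Fintype σ] :
    (1 + ∑ j, X j : MvPolynomial σ K) ≠ 0 := by
  intro h
  have := congrArg constantCoeff h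
  simp at this

/-- The inverse substitution xᵢ = zᵢ / s, with zₖ = 1 and s = ∑ zᵢ, extends to `G : L →+* Q`, and
`G` composed with `ratioHom` is the embedding `a`. -/
lemma ratioHom_injective_of_injective {Q : Type*} [Field Q] {a : MvPolynomial (Fin n) K →+* Q}
    (ha : Function.Injective a) {v : L} (hv : algebraMap _ L (baryCoord K n k) * v = 1)
    [IsLocalization.Away (baryCoord K n k ^ 2) L] :
    Function.Injective (ratioHom (K := K) k v) := by
  obtain ⟨s, hs', hs⟩ : ∃ s, s = a (1 + ∑ j, X j) ∧ s ≠ 0 :=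
    ⟨_, rfl, (map_ne_zero_iff a ha).mpr (one_add_sum_X_ne_zero (Fin n))⟩
  let z : Fin (n + 1) → Q := Fin.insertNth k 1 fun j ↦ a (X j)
  have hz : ∑ i, z i = s := by
    simp [z, hs', Fin.sum_univ_succAbove _ k]
  let g : MvPolynomial (Fin n) K →+* Q := eval₂Hom (a.comp C) fun j ↦ z j.succ * s⁻¹
  have hg (i : Fin (n + 1)) : g (baryCoord K n i) = z i * s⁻¹ := by
    refine Fin.cases ?_ (fun j ↦ ?_) i
    · rw [Fin.sum_univ_succ] at hz
      simp only [baryCoord, Fin.cons_zero, map_sub, map_one, map_sum]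
      simp only [g, coe_eval₂Hom, eval₂_X, ← Finset.sum_mul]
      field_simp
      linear_combination -hz
    · simp [baryCoord, g]
  have hk : g (baryCoord K n k) = s⁻¹ := by simp [hg, z]
  have hu : IsUnit (g (baryCoord K n k ^ 2)) := by
    rw [map_pow, hk]
    exact (isUnit_iff_ne_zero.mpr (inv_ne_zero hs)).pow 2
  let G : L →+* Q := IsLocalization.Away.lift _ hu
  have hG (p) : G (algebraMap _ L p) = g p := IsLocalization.Away.lift_eq _ hu p
  have hGv : G v = s := by
    have := congrArg G hv
    rw [map_mul, hG, hk, map_one] at this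
    field_simp at this
    exact this
  have hcomp : G.comp (ratioHom k v) = a := by
    refine MvPolynomial.ringHom_ext (fun r ↦ ?_) (fun j ↦ ?_)
    · simp [hG, g]
    · simp [hG, hg, hGv, hs, z]
  rw [← hcomp] at ha
  exact Function.Injective.of_comp (f := G) ha

lemma ratioHom_injective {v : L} (hv : algebraMap _ L (baryCoord K n k) * v = 1)
    [IsLocalization.Away (baryCoord K n k ^ 2) L] :
    Function.Injective (ratioHom (K := K) k v) :=
  ratioHom_injective_of_injective k
    (IsFractionRing.injective _ (FractionRing (MvPolynomial (Fin n) K))) hv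

lemma isLocalizationAway_ratioHom {v : L} (hv : algebraMap _ L (baryCoord K n k) * v = 1)
    [IsLocalization.Away (baryCoord K n k ^ 2) L] :
    letI := (ratioHom (K := K) k v).toAlgebra
    IsLocalization.Away (1 + ∑ j, X j : MvPolynomial (Fin n) K) L := by
  have hs := ratioHom_one_add_sum k hv
  refine isLocalizationAway_of_injective _ (ratioHom_injective k hv) _ ?_ fun x ↦ ?_
  · rw [hs]
    exact IsUnit.of_mul_eq_one_right _ hv
  · rw [hs]
    exact exists_mul_pow_eq_ratioHom k hv x

end BarycentricField

/-! ### Degrees of dominant morphisms as ranks of ring homomorphisms -/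

section FinrankHom

variable {A B C : Type*} [CommRing A] [CommRing B] [CommRing C]

/-- The rank of `B` as a module over `A` along a ring homomorphism. -/
def finrankHom (φ : A →+* B) : ℕ :=
  letI := φ.toAlgebra
  Module.finrank A B

lemma finrankHom_comp (hA : IsField A) (hB : IsField B) (φ : A →+* B) (ψ : B →+* C) :
    finrankHom (ψ.comp φ) = finrankHom φ * finrankHom ψ := by
  let := hA.toField
  let := hB.toField
  let := φ.toAlgebra
  let := ψ.toAlgebra
  let := (ψ.comp φ).toAlgebra
  have : IsScalarTower A B C := .of_algebraMap_eq' rfl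
  exact (Module.finrank_mul_finrank A B C).symm

lemma finrankHom_of_bijective [Nontrivial A] (φ : A →+* B) (hφ : Function.Bijective φ) :
    finrankHom φ = 1 := by
  let := φ.toAlgebra
  have h := (AlgEquiv.ofBijective (Algebra.ofId A B) hφ).toLinearEquiv.finrank_eq
  exact h.symm.trans (Module.finrank_self A)

lemma isFractionRing_atPrime (I : Ideal A) [I.IsPrime] [IsDomain A] (hI : I = ⊥) :
    IsFractionRing A (Localization.AtPrime I) := by
  have h : I.primeCompl = nonZeroDivisors A := by
    ext x
    simp [hI, Ideal.primeCompl]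
  rw [IsFractionRing, ← h]
  exact Localization.isLocalization

/-- The local rings at the zero ideals are the fraction fields, and passing to fraction fields
preserves the rank. -/
lemma finrankHom_localRingHom [IsDomain A] [IsDomain B] (φ : A →+* B) (I : Ideal A) (J : Ideal B)
    [I.IsPrime] [J.IsPrime] (hI : I = ⊥) (hJ : J = ⊥) (h : I = J.comap φ) :
    finrankHom (Localization.localRingHom I J φ h) = finrankHom φ := by
  let := φ.toAlgebra
  let := (Localization.localRingHom I J φ h).toAlgebra
  have := isFractionRing_atPrime I hI
  have := isFractionRing_atPrime J hJ
  have : IsScalarTower A (Localization.AtPrime I) (Localization.AtPrime J) :=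
    .of_algebraMap_eq fun x ↦ (Localization.localRingHom_to_map I J φ h x).symm
  exact IsFractionRing.finrank_eq A (Localization.AtPrime I) B (Localization.AtPrime J)

end FinrankHom

section Degree

variable {X Y Z : Scheme.{u}}

lemma degree_eq_finrankHom [IrreducibleSpace X] (f : X ⟶ Y) :
    degree f = finrankHom (f.stalkMap (genericPoint X)).hom := rfl

lemma isField_stalk_of_eq_genericPoint [IsIntegral X] {x : X} (hx : x = genericPoint X) :
    IsField (X.presheaf.stalk x) := by
  subst hx
  exact Field.toIsField X.functionField

lemma degree_comp [IsIntegral X] [IsIntegral Y] [IsIntegral Z] (f : X ⟶ Y) (g : Y ⟶ Z)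
    [IsDominant f] [IsDominant g] : degree (f ≫ g) = degree g * degree f := by
  -- The stalk map of `g` appears at `f (genericPoint X)`, which equals the generic point of `Y`
  -- only propositionally.
  have key (y : Y) (hy : f (genericPoint X) = y) (hy' : y = genericPoint Y) :
      degree g = finrankHom (g.stalkMap y).hom := by
    subst hy'
    rfl
  rw [key _ rfl (map_genericPoint f), degree_eq_finrankHom, degree_eq_finrankHom,
    Scheme.Hom.stalkMap_comp]
  refine finrankHom_comp (isField_stalk_of_eq_genericPoint ?_)
    (isField_stalk_of_eq_genericPoint (map_genericPoint f)) _ _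
  rw [map_genericPoint f, map_genericPoint g]

lemma degree_of_isOpenImmersion [IsIntegral X] (f : X ⟶ Y) [IsOpenImmersion f] :
    degree f = 1 := by
  rw [degree_eq_finrankHom]
  have h : Function.Bijective (f.stalkMap (genericPoint X)).hom :=
    ConcreteCategory.bijective_of_isIso (f.stalkMap (genericPoint X))
  have : Nontrivial (Y.presheaf.stalk (f (genericPoint X))) := inferInstance
  exact finrankHom_of_bijective _ h

lemma finrankHom_stalkMap_SpecMap {R S : CommRingCat.{u}} [IsDomain R] [IsDomain S] (φ : R ⟶ S)
    (hφ : Function.Injective φ.hom) (p : PrimeSpectrum S) (hp : p.asIdeal = ⊥) :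
    finrankHom ((Spec.map φ).stalkMap p).hom = finrankHom φ.hom := by
  have hI : (p.comap φ.hom).asIdeal = ⊥ := by
    rw [PrimeSpectrum.comap_asIdeal, hp]
    exact (RingHom.injective_iff_ker_eq_bot _).mp hφ
  have hR : IsField (Localization.AtPrime (p.comap φ.hom).asIdeal) := by
    have := isFractionRing_atPrime _ hI
    exact (IsFractionRing.toField R).toIsField
  have hS : IsField (Localization.AtPrime p.asIdeal) := by
    have := isFractionRing_atPrime _ hp
    exact (IsFractionRing.toField S).toIsField
  have hiso := ConcreteCategory.bijective_of_isIso (Spec.stalkIso R (p.comap φ.hom)).hom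
  have hiso' := ConcreteCategory.bijective_of_isIso (Spec.stalkIso S p).inv
  have hR' : IsField ((Spec R).presheaf.stalk (p.comap φ.hom)) :=
    MulEquiv.isField hR (RingEquiv.ofBijective _ hiso).toMulEquiv
  have := hR.nontrivial
  have := hS.nontrivial
  have := hR'.nontrivial
  have h : finrankHom ((Spec.map φ).stalkMap p).hom =
      finrankHom (((Spec.stalkIso S p).inv.hom.comp (Localization.localRingHom
        (p.comap φ.hom).asIdeal p.asIdeal φ.hom rfl)).comp
          (Spec.stalkIso R (p.comap φ.hom)).hom.hom) :=
    congrArg (fun g ↦ finrankHom (CommRingCat.Hom.hom g))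
      (Scheme.localRingHom_comp_stalkIso φ p).symm
  rw [h, finrankHom_comp hR' hR, finrankHom_comp hR hS, finrankHom_of_bijective _ hiso,
    finrankHom_of_bijective _ hiso', mul_one, one_mul]
  exact finrankHom_localRingHom _ _ _ hI hp rfl

lemma degree_SpecMap {R S : CommRingCat.{u}} [IsDomain R] [IsDomain S] (φ : R ⟶ S)
    (hφ : Function.Injective φ.hom) : degree (Spec.map φ) = finrankHom φ.hom := by
  refine finrankHom_stalkMap_SpecMap φ hφ (genericPoint (Spec S)) ?_
  rw [genericPoint_eq_bot_of_affine]
  rfl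

end Degree

/-! ### Krull dimension from an open cover -/

section Dimension

open TopologicalSpace

lemma topologicalKrullDim_le_of_openCover {X : Type*} [TopologicalSpace X] {ι : Type*}
    {U : ι → Type*} [∀ i, TopologicalSpace (U i)] (f : ∀ i, U i → X)
    (hf : ∀ i, Topology.IsOpenEmbedding (f i)) (hcov : ∀ x, ∃ i, x ∈ Set.range (f i))
    {d : WithBot ℕ∞} (hd : ∀ i, topologicalKrullDim (U i) ≤ d) : topologicalKrullDim X ≤ d := by
  refine iSup_le fun p ↦ ?_
  obtain ⟨x, hx⟩ := p.head.isIrreducible.nonempty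
  obtain ⟨i, y, rfl⟩ := hcov x
  -- An open set meeting the smallest member of the chain meets all of them, so the whole chain
  -- restricts to it without collapsing.
  have mem (j) : p j ∈ {V : IrreducibleCloseds X | (f i ⁻¹' V).Nonempty} :=
    ⟨y, (p.head_le j : _) hx⟩
  let e := IrreducibleCloseds.orderIsoOfIsOpenEmbedding (f i) (hf i)
  let q : LTSeries (IrreducibleCloseds (U i)) :=
    { length := p.length
      toFun := fun j ↦ e.symm ⟨p j, mem j⟩
      step := fun j ↦ e.symm.strictMono (p.step j) }
  exact (Order.LTSeries.length_le_krullDim q).trans (hd i)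

end Dimension

/-! ### Morphisms to Proj over basic opens, and the standard charts -/

section Away

variable {A σ : Type*} [CommRing A] [SetLike σ A] [AddSubgroupClass σ A] (𝒜 : ℕ → σ)
  [GradedRing 𝒜] {C : Type*} [CommRing C]

/-- The ring homomorphism from the degree zero part of `A[1/r]` to `C[1/g(r)]` induced by
`g : A →+* C`. -/
def awayHom (g : A →+* C) (r : A) : Away 𝒜 r →+* Localization.Away (g r) :=
  (IsLocalization.map (M := .powers r) (T := .powers (g r)) _ g
    (by rw [← Submonoid.map_le_iff_le_comap, Submonoid.map_powers])).comp
      (algebraMap (Away 𝒜 r) (Localization.Away r))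

lemma awayHom_apply_mul (g : A →+* C) (r : A) (x : Away 𝒜 r) (a : A) (N : ℕ)
    (hx : x.val * algebraMap A _ (r ^ N) = algebraMap A (Localization.Away r) a) :
    awayHom 𝒜 g r x * algebraMap C _ (g r) ^ N = algebraMap C _ (g a) := by
  have h : Submonoid.powers r ≤ (Submonoid.powers (g r)).comap g := by
    rw [← Submonoid.map_le_iff_le_comap, Submonoid.map_powers]
  have := congrArg (IsLocalization.map (Localization.Away (g r)) g h) hx
  rwa [map_mul, IsLocalization.map_eq, IsLocalization.map_eq, map_pow, map_pow] at this

end Away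

section GlobalSections

variable {A σ : Type u} [CommRing A] [SetLike σ A] [AddSubgroupClass σ A] (𝒜 : ℕ → σ)
  [GradedRing 𝒜] {X : Scheme.{u}} [IsAffine X]

lemma exists_fromOfGlobalSections_morphismRestrict_eq (g : A →+* Γ(X, ⊤))
    (hg : (HomogeneousIdeal.irrelevant 𝒜).toIdeal.map g = ⊤) {r : A} {d : ℕ} (hd : 0 < d)
    (hr : r ∈ 𝒜 d) :
    ∃ e : (Proj.fromOfGlobalSections 𝒜 g hg ⁻¹ᵁ Proj.basicOpen 𝒜 r).toScheme ≅
        Spec (.of (Localization.Away (g r))),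
      Proj.fromOfGlobalSections 𝒜 g hg ∣_ Proj.basicOpen 𝒜 r =
        e.hom ≫ Spec.map (CommRingCat.ofHom (awayHom 𝒜 g r)) ≫
          (Proj.basicOpenIsoSpec 𝒜 r hr hd).inv := by
  have : IsIso (X.toSpecΓ ∣_ PrimeSpectrum.basicOpen (g r)) :=
    (inferInstance : ∀ U : (Spec Γ(X, ⊤)).Opens, IsIso (X.toSpecΓ ∣_ U)) _
  refine ⟨Scheme.isoOfEq _ (Proj.fromOfGlobalSections_preimage_basicOpen _ _ _ hd hr) ≪≫
    (X.isoOfEq (X.toSpecΓ_preimage_basicOpen (g r))).symm ≪≫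
      asIso (X.toSpecΓ ∣_ PrimeSpectrum.basicOpen (g r)) ≪≫ basicOpenIsoSpecAway (g r), ?_⟩
  rw [Proj.fromOfGlobalSections_morphismRestrict 𝒜 g hg hd hr]
  simp [Proj.toBasicOpenOfGlobalSections, awayHom]

end GlobalSections

section Chart

lemma X_mem_homogeneousSubmodule {ι : Type*} (R : Type*) [CommSemiring R] (i : ι) :
    (X i : MvPolynomial ι R) ∈ homogeneousSubmodule ι R 1 :=
  isHomogeneous_X R i

variable {K : Type*} [Field K] {n : ℕ} (k : Fin (n + 1))

/-- The coordinates `Xⱼ / Xₖ` (`j ≠ k`) of the standard chart `Xₖ ≠ 0` of projective space. -/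
def chartHom : MvPolynomial (Fin n) K →+*
    Away (homogeneousSubmodule (Fin (n + 1)) K) (X k : MvPolynomial (Fin (n + 1)) K) :=
  eval₂Hom ((algebraMap (homogeneousSubmodule (Fin (n + 1)) K 0) _).comp
      (algebraMap K (homogeneousSubmodule (Fin (n + 1)) K 0)))
    fun j ↦ Away.mk _ (d := 1) (X_mem_homogeneousSubmodule K k) 1 (X (k.succAbove j))
      (by simpa using X_mem_homogeneousSubmodule K (k.succAbove j))

lemma val_chartHom_C (r : K) :
    (chartHom k (C r)).val = algebraMap (MvPolynomial (Fin (n + 1)) K) _ (C r) := by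
  simp only [chartHom, coe_eval₂Hom, eval₂_C]
  rfl

lemma val_chartHom_X_mul (j : Fin n) :
    (chartHom k (X j : MvPolynomial (Fin n) K)).val *
        algebraMap (MvPolynomial (Fin (n + 1)) K) _ (X k) =
      algebraMap (MvPolynomial (Fin (n + 1)) K) _ (X (k.succAbove j)) := by
  simp only [chartHom, coe_eval₂Hom, eval₂_X, Away.val_mk, Localization.mk_eq_mk']
  simp

lemma map_eq_mul_pow_of_isHomogeneous {ι R M : Type*} [CommRing R] [CommRing M]
    (φ ψ : MvPolynomial ι R →+* M) (w : M) (hC : ∀ r, φ (C r) = ψ (C r))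
    (hX : ∀ i, φ (X i) = ψ (X i) * w) {a : MvPolynomial ι R} {N : ℕ} (ha : a.IsHomogeneous N) :
    φ a = ψ a * w ^ N := by
  rw [a.as_sum, map_sum, map_sum, Finset.sum_mul]
  refine Finset.sum_congr rfl fun m hm ↦ ?_
  have hN : m.degree = N := by
    rw [← ha (mem_support_iff.mp hm), Finsupp.degree_eq_weight_one]
    rfl
  rw [monomial_eq, map_mul, map_mul, hC, mul_assoc, ← hN]
  congr 1
  rw [Finsupp.prod, Finsupp.degree_apply, map_prod, map_prod, ← Finset.prod_pow_eq_pow_sum,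
    ← Finset.prod_mul_distrib]
  exact Finset.prod_congr rfl fun i _ ↦ by rw [map_pow, map_pow, hX, mul_pow]

lemma chartHom_surjective : Function.Surjective (chartHom (K := K) k) := by
  intro x
  obtain ⟨N, a, ha, rfl⟩ := Away.mk_surjective _ (d := 1) (X_mem_homogeneousSubmodule K k) x
  -- Dehomogenization at Xₖ = 1 gives the preimage.
  let δ : MvPolynomial (Fin (n + 1)) K →+* MvPolynomial (Fin n) K :=
    (aeval (Fin.insertNth k 1 X : Fin (n + 1) → MvPolynomial (Fin n) K)).toRingHom
  let ν := algebraMap (Away (homogeneousSubmodule (Fin (n + 1)) K)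
    (X k : MvPolynomial (Fin (n + 1)) K)) (Localization.Away (X k : MvPolynomial (Fin (n + 1)) K))
  let ι := algebraMap (MvPolynomial (Fin (n + 1)) K)
    (Localization.Away (X k : MvPolynomial (Fin (n + 1)) K))
  let w : Localization.Away (X k : MvPolynomial (Fin (n + 1)) K) :=
    IsLocalization.Away.invSelf (X k : MvPolynomial (Fin (n + 1)) K)
  have hw : ι (X k) * w = 1 := IsLocalization.Away.mul_invSelf _
  refine ⟨δ a, HomogeneousLocalization.val_injective _ ?_⟩
  have h := map_eq_mul_pow_of_isHomogeneous ((ν.comp (chartHom k)).comp δ) ι w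
    (fun r ↦ by simpa [δ, ν, ι] using val_chartHom_C k r) (fun i ↦ ?_)
    (by simpa using ha : a.IsHomogeneous N)
  · refine h.trans ?_
    rw [Away.val_mk, Localization.mk_eq_mk', IsLocalization.eq_mk'_iff_mul_eq]
    change ι a * w ^ N * ι (X k ^ N) = ι a
    rw [map_pow, mul_assoc, ← mul_pow, mul_comm w, hw, one_pow, mul_one]
  · rcases Fin.eq_self_or_eq_succAbove k i with rfl | ⟨j, rfl⟩
    · simp [δ, hw]
    · have h' : ν (chartHom k (X j)) * ι (X k) = ι (X (k.succAbove j)) := val_chartHom_X_mul k j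
      have h'' : δ (X (k.succAbove j)) = X j := by simp [δ]
      rw [RingHom.comp_apply, RingHom.comp_apply, h'', ← h', mul_assoc, hw, mul_one]

end Chart

/-! ### The squaring map on coordinate rings of charts -/

section ChartFactorization

variable {K : Type*} [Field K] {n : ℕ} {D : Type*} [CommRing D]

/-- The homomorphism `Xᵢ ↦ xᵢ²`, where `x` are the coordinates of affine space adding up to `1`. -/
def squareHom (e : MvPolynomial (Fin n) K ≃+* D) : MvPolynomial (Fin (n + 1)) K →+* D :=
  e.toRingHom.comp (aeval fun i ↦ baryCoord K n i ^ 2).toRingHom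

variable (e : MvPolynomial (Fin n) K ≃+* D)

@[simp]
lemma squareHom_X (i : Fin (n + 1)) : squareHom e (X i) = e (baryCoord K n i ^ 2) := by
  simp [squareHom]

@[simp]
lemma squareHom_C (r : K) : squareHom e (C r) = e (C r) := by
  simp [squareHom]

lemma eq_top_of_squareHom_X_mem {I : Ideal D} (h : ∀ i, squareHom e (X i) ∈ I) : I = ⊤ := by
  by_contra hI
  obtain ⟨M, hM, hIM⟩ := Ideal.exists_le_maximal I hI
  refine hM.ne_top ((Ideal.eq_top_iff_one _).mpr ?_)
  have h1 : e (∑ i, baryCoord K n i) ∈ M := by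
    rw [map_sum]
    -- The xᵢ² have no common zero: at such a point every xᵢ would vanish, although they add up to
    -- 1.
    refine sum_mem fun i _ ↦ hM.isPrime.mem_of_pow_mem 2 ?_
    rw [← map_pow, ← squareHom_X]
    exact hIM (h i)
  rwa [sum_baryCoord, map_one] at h1

lemma exists_awayHom_comp_chartHom_eq (k : Fin (n + 1)) :
    ∃ θ : MvPolynomial (Fin n) K →+* Localization.Away (squareHom e (X k)),
      @IsLocalization.Away _ _ (1 + ∑ j, X j) _ _ θ.toAlgebra ∧
      (awayHom (homogeneousSubmodule (Fin (n + 1)) K) (squareHom e) (X k)).comp (chartHom k) =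
        θ.comp (powHom K fun _ ↦ 2).toRingHom := by
  let L := Localization.Away (squareHom e (X k))
  let a := algebraMap D L
  let := (a.comp e.toRingHom).toAlgebra
  have ha (p) : algebraMap (MvPolynomial (Fin n) K) L p = a (e p) := rfl
  have hX (i) : a (squareHom e (X i)) =
      algebraMap (MvPolynomial (Fin n) K) L (baryCoord K n i) ^ 2 :=
    (congrArg a (squareHom_X e i)).trans (by rw [← ha, map_pow])
  have : IsLocalization.Away (baryCoord K n k ^ 2) L := by
    have hk : algebraMap (MvPolynomial (Fin n) K) L (baryCoord K n k ^ 2) =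
        a (squareHom e (X k)) := congrArg a (squareHom_X e k).symm
    refine .mk _ ?_ (fun x ↦ ?_) (fun p q h ↦ ?_)
    · rw [hk]
      exact IsLocalization.Away.algebraMap_isUnit _
    · obtain ⟨N, y, h⟩ := IsLocalization.Away.surj (squareHom e (X k)) x
      exact ⟨N, e.symm y, by rw [hk, ha, e.apply_symm_apply]; exact h⟩
    · obtain ⟨N, h⟩ := IsLocalization.Away.exists_of_eq (squareHom e (X k)) h
      exact ⟨N, e.injective (by simpa using h)⟩
  obtain ⟨v, hv⟩ : ∃ v, algebraMap _ L (baryCoord K n k) * v = 1 := by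
    refine ⟨algebraMap _ L (baryCoord K n k) *
      IsLocalization.Away.invSelf (baryCoord K n k ^ 2), ?_⟩
    rw [← mul_assoc, ← map_mul, ← pow_two]
    exact IsLocalization.Away.mul_invSelf _
  refine ⟨ratioHom k v, isLocalizationAway_ratioHom k hv, ?_⟩
  refine MvPolynomial.ringHom_ext (fun r ↦ ?_) (fun j ↦ ?_)
  · have := awayHom_apply_mul (homogeneousSubmodule (Fin (n + 1)) K) (squareHom e) (X k)
      (chartHom k (C r)) (C r) 0 (by simpa using val_chartHom_C k r)
    rw [pow_zero, mul_one] at this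
    rw [RingHom.comp_apply, this]
    simp [ha, a, L]
  · have := awayHom_apply_mul (homogeneousSubmodule (Fin (n + 1)) K) (squareHom e) (X k)
      (chartHom k (X j)) (X (k.succAbove j)) 1 (by simpa using val_chartHom_X_mul k j)
    change _ * a _ ^ 1 = a _ at this
    rw [hX, hX, pow_one] at this
    have h2 : (ratioHom k v).comp (powHom K fun _ ↦ 2).toRingHom (X j) =
      (algebraMap _ L (baryCoord K n (k.succAbove j)) * v) ^ 2 := by simp
    rw [h2, RingHom.comp_apply]
    -- Multiply (image of Xⱼ/Xₖ) · xₖ² = xⱼ² by `v ^ 2`, using (xₖv)² - 1 = (xₖv + 1)(xₖv - 1).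
    linear_combination v ^ 2 * this - (awayHom _ (squareHom e) (X k) (chartHom k (X j))) *
      (algebraMap _ L (baryCoord K n k) * v + 1) * hv

end ChartFactorization

/-! ### Geometry of power maps, and avoiding the hyperplane -/

section PowHom

variable {σ : Type*} [Fintype σ] (K : Type*) [Field K] {d : σ → ℕ}

lemma finite_powHom (hd : ∀ i, 0 < d i) : (powHom K d).toRingHom.Finite :=
  PowCover.finite K d hd

lemma flat_powHom (hd : ∀ i, 0 < d i) : (powHom K d).toRingHom.Flat :=
  have := PowCover.free K d hd
  (inferInstance : Module.Flat (MvPolynomial σ K) (PowCover K d))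

lemma finrankHom_powHom (hd : ∀ i, 0 < d i) : finrankHom (powHom K d).toRingHom = ∏ i, d i :=
  PowCover.finrank K d hd

lemma comap_powHom_surjective (hd : ∀ i, 0 < d i) :
    Function.Surjective (PrimeSpectrum.comap (powHom K d).toRingHom) := by
  have := PowCover.finite K d hd
  have : FaithfulSMul (MvPolynomial σ K) (PowCover K d) :=
    (faithfulSMul_iff_algebraMap_injective _ _).mpr (powHom_injective K d hd)
  exact Algebra.IsIntegral.comap_surjective (MvPolynomial σ K) (PowCover K d)

/-- Every prime of `K[y]` lies under a prime of `K[z]`, `z² = y`, not containing `1 + ∑ zⱼ`. -/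
lemma exists_comap_powHom_eq_notMem [NeZero (2 : K)] (p : PrimeSpectrum (MvPolynomial σ K)) :
    ∃ q : PrimeSpectrum (MvPolynomial σ K),
      PrimeSpectrum.comap (powHom K fun _ ↦ 2).toRingHom q = p ∧
        (1 + ∑ j, X j : MvPolynomial σ K) ∉ q.asIdeal := by
  obtain ⟨q, rfl⟩ := comap_powHom_surjective K (d := fun _ : σ ↦ 2) (fun _ ↦ two_pos) p
  by_cases hq : (1 + ∑ j, X j : MvPolynomial σ K) ∈ q.asIdeal
  -- The sign change z ↦ -z fixes every z², and the two values 1 ± ∑ zⱼ add up to the unit 2, so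
  -- they cannot both lie in `q`.
  · let ε : MvPolynomial σ K →+* MvPolynomial σ K := (aeval fun i ↦ -X i).toRingHom
    refine ⟨PrimeSpectrum.comap ε q, ?_, fun h ↦ ?_⟩
    · have : ε.comp (powHom K fun _ ↦ 2).toRingHom = (powHom K fun _ ↦ 2).toRingHom :=
        MvPolynomial.ringHom_ext (fun r ↦ by simp [ε]) (fun i ↦ by simp [ε])
      rw [← PrimeSpectrum.comap_comp_apply, this]
    · have h2 : (1 + ∑ j, X j : MvPolynomial σ K) + ε (1 + ∑ j, X j) = C 2 := by
        have : ε (1 + ∑ j, X j) = 1 - ∑ j, X j := by simp [ε, sub_eq_add_neg]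
        rw [this, map_ofNat]
        ring
      have h3 : C (2 : K) ∈ q.asIdeal := h2 ▸ add_mem hq h
      exact q.2.ne_top (Ideal.eq_top_of_isUnit_mem _ h3 ((NeZero.ne (2 : K)).isUnit.map C))
  · exact ⟨q, rfl, hq⟩

end PowHom

lemma isDominant_of_isOpenImmersion {X Y : Scheme.{u}} [Nonempty X] [IrreducibleSpace Y]
    (f : X ⟶ Y) [IsOpenImmersion f] : IsDominant f :=
  ⟨f.isOpenEmbedding.isOpen_range.dense (Set.range_nonempty f)⟩

/-! ### The squaring morphism to projective space -/

section SquareMap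

variable (K : Type u) [Field K] (n : ℕ)

/-- The spectrum of `K[t₁, …, tₙ]`. -/
abbrev polySpec : Scheme.{u} := Spec (.of (MvPolynomial (Fin n) K))

/-- The polynomial ring as the ring of global sections of its spectrum. -/
def polyEquivΓ : MvPolynomial (Fin n) K ≃+* Γ(polySpec K n, ⊤) :=
  (Scheme.ΓSpecIso (.of (MvPolynomial (Fin n) K))).symm.commRingCatIsoToRingEquiv

lemma map_irrelevant_squareHom {D : Type*} [CommRing D] (e : MvPolynomial (Fin n) K ≃+* D) :
    (HomogeneousIdeal.irrelevant (homogeneousSubmodule (Fin (n + 1)) K)).toIdeal.map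
      (squareHom e) = ⊤ := by
  refine eq_top_of_squareHom_X_mem e fun i ↦ Ideal.mem_map_of_mem _ ?_
  exact HomogeneousIdeal.mem_irrelevant_of_mem _ one_pos (X_mem_homogeneousSubmodule K i)

/-- The morphism `t ↦ [x₀² : … : xₙ²]` from affine to projective space, where `x₀, …, xₙ` are the
coordinates of affine space adding up to `1`. -/
def squareMap : polySpec K n ⟶ projectiveSpace K n :=
  Proj.fromOfGlobalSections (homogeneousSubmodule (Fin (n + 1)) K) (squareHom (polyEquivΓ K n))
    (map_irrelevant_squareHom K n _)

/-- The standard open subscheme `Xₖ ≠ 0` of projective space. -/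
def chartOpen (k : Fin (n + 1)) : (projectiveSpace K n).Opens :=
  Proj.basicOpen (homogeneousSubmodule (Fin (n + 1)) K) (X k)

lemma iSup_chartOpen : ⨆ k, chartOpen K n k = ⊤ := by
  refine Proj.iSup_basicOpen_eq_top' _ X (fun i ↦ ⟨1, X_mem_homogeneousSubmodule K i⟩) ?_
  rw [eq_top_iff]
  rintro p -
  induction p using MvPolynomial.induction_on with
  | C r =>
    exact Subalgebra.algebraMap_mem _
      (⟨C r, isHomogeneous_C _ r⟩ : homogeneousSubmodule (Fin (n + 1)) K 0)
  | add p q hp hq => exact add_mem hp hq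
  | mul_X p i hp => exact mul_mem hp (Algebra.subset_adjoin ⟨i, rfl⟩)

variable {n} in
-- In the coordinates zⱼ = xⱼ/xₖ the map is z ↦ z² on the open set 1 + ∑ zⱼ ≠ 0, since 1 + ∑ zⱼ =
-- 1/xₖ. Flatness, quasi-finiteness, surjectivity and the degree are all read off from this form.
lemma exists_squareMap_morphismRestrict_eq (k : Fin (n + 1)) :
    ∃ (j : (squareMap K n ⁻¹ᵁ chartOpen K n k).toScheme ⟶ polySpec K n)
      (c : polySpec K n ≅ (chartOpen K n k).toScheme), IsOpenImmersion j ∧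
      Set.range j = {q | (1 + ∑ i, X i : MvPolynomial (Fin n) K) ∉ q.asIdeal} ∧
      squareMap K n ∣_ chartOpen K n k =
        j ≫ Spec.map (CommRingCat.ofHom (powHom K fun _ ↦ 2).toRingHom) ≫ c.hom := by
  obtain ⟨θ, hθ, h⟩ := exists_awayHom_comp_chartHom_eq (polyEquivΓ K n) k
  obtain ⟨e, c, he⟩ : ∃ (e : (squareMap K n ⁻¹ᵁ chartOpen K n k).toScheme ≅
      Spec (.of (Localization.Away (squareHom (polyEquivΓ K n) (X k)))))
      (c : Spec (.of (Away (homogeneousSubmodule (Fin (n + 1)) K) (X k))) ≅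
        (chartOpen K n k).toScheme), squareMap K n ∣_ chartOpen K n k =
        e.hom ≫ Spec.map (CommRingCat.ofHom (awayHom _ (squareHom (polyEquivΓ K n)) (X k))) ≫
          c.hom := by
    obtain ⟨e, he⟩ := exists_fromOfGlobalSections_morphismRestrict_eq
      (homogeneousSubmodule (Fin (n + 1)) K) (squareHom (polyEquivΓ K n))
      (map_irrelevant_squareHom K n _) one_pos (X_mem_homogeneousSubmodule K k)
    exact ⟨e, (Proj.basicOpenIsoSpec _ _ (X_mem_homogeneousSubmodule K k) one_pos).symm, he⟩
  have hθ_inj : Function.Injective θ :=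
    @IsLocalization.injective _ _ (.powers (1 + ∑ i, X i)) _ _ θ.toAlgebra hθ
      (powers_le_nonZeroDivisors_of_noZeroDivisors (one_add_sum_X_ne_zero (Fin n)))
  -- Injectivity of `chartHom` comes from the factorization `h`: its composite with `awayHom` equals
  -- the injective map `θ ∘ powHom`.
  have hbij : Function.Bijective (chartHom (K := K) k) := by
    refine ⟨.of_comp (f := awayHom (homogeneousSubmodule (Fin (n + 1)) K)
      (squareHom (polyEquivΓ K n)) (X k)) ?_, chartHom_surjective k⟩
    rw [← RingHom.coe_comp, h]
    exact hθ_inj.comp (powHom_injective K _ fun _ ↦ two_pos)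
  have : IsIso (CommRingCat.ofHom (chartHom (K := K) k)) :=
    (ConcreteCategory.isIso_iff_bijective _).mpr hbij
  have : IsOpenImmersion (Spec.map (CommRingCat.ofHom θ)) :=
    @IsOpenImmersion.of_isLocalization _ _ _ _ θ.toAlgebra _ hθ
  have hrange : Set.range (Spec.map (CommRingCat.ofHom θ)) =
      {q | (1 + ∑ i, X i : MvPolynomial (Fin n) K) ∉ q.asIdeal} :=
    @PrimeSpectrum.localization_away_comap_range _ _ _ _ θ.toAlgebra _ hθ
  refine ⟨e.hom ≫ Spec.map (CommRingCat.ofHom θ), (asIso (Spec.map (CommRingCat.ofHom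
    (chartHom (K := K) k)))).symm ≪≫ c, inferInstance, ?_, ?_⟩
  · rw [← hrange]
    have : ⇑(e.hom ≫ Spec.map (CommRingCat.ofHom θ)) =
      Spec.map (CommRingCat.ofHom θ) ∘ e.hom := by ext; simp
    rw [this, e.hom.surjective.range_comp]
  · rw [he, Iso.trans_hom, Category.assoc, ← Spec.map_comp_assoc, ← CommRingCat.ofHom_comp, ← h,
      CommRingCat.ofHom_comp, Spec.map_comp_assoc, Iso.symm_hom, asIso_inv, IsIso.hom_inv_id_assoc]

end SquareMap

section PowMap

variable (K : Type u) [Field K] {n : ℕ} (d : Fin n → ℕ)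

/-- The morphism `t ↦ (tᵢ ^ dᵢ)ᵢ` from affine space to itself. -/
def powMap : polySpec K n ⟶ polySpec K n :=
  Spec.map (CommRingCat.ofHom (powHom K d).toRingHom)

variable {d}

lemma flat_powMap (hd : ∀ i, 0 < d i) : Flat (powMap K d) :=
  Flat.SpecMap_iff.mpr (flat_powHom K hd)

lemma isFinite_powMap (hd : ∀ i, 0 < d i) : IsFinite (powMap K d) :=
  (IsFinite.SpecMap_iff _).mpr (finite_powHom K hd)

lemma surjective_powMap (hd : ∀ i, 0 < d i) : Surjective (powMap K d) :=
  ⟨comap_powHom_surjective K hd⟩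

lemma degree_powMap (hd : ∀ i, 0 < d i) : degree (powMap K d) = ∏ i, d i :=
  (degree_SpecMap _ (powHom_injective K d hd)).trans (finrankHom_powHom K hd)

end PowMap

/-! ### Properties of the squaring morphism and of projective space -/

section SquareMapProperties

variable (K : Type u) [Field K] (n : ℕ)

lemma of_chartOpen (P : MorphismProperty Scheme.{u}) [IsZariskiLocalAtTarget P]
    (h : ∀ k, P (squareMap K n ∣_ chartOpen K n k)) : P (squareMap K n) :=
  (IsZariskiLocalAtTarget.iff_of_iSup_eq_top _ (iSup_chartOpen K n)).mpr h

lemma flat_squareMap : Flat (squareMap K n) := by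
  have : IsZariskiLocalAtTarget (@Flat : MorphismProperty Scheme.{u}) :=
    HasRingHomProperty.instIsZariskiLocalAtTarget _
  refine of_chartOpen K n @Flat fun k ↦ ?_
  obtain ⟨j, c, hj, -, h⟩ := exists_squareMap_morphismRestrict_eq K k
  have := flat_powMap K (d := fun _ : Fin n ↦ 2) fun _ ↦ two_pos
  change _ = j ≫ powMap K _ ≫ c.hom at h
  rw [h]
  infer_instance

lemma locallyQuasiFinite_squareMap : LocallyQuasiFinite (squareMap K n) := by
  have : IsZariskiLocalAtTarget (@LocallyQuasiFinite : MorphismProperty Scheme.{u}) :=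
    HasRingHomProperty.instIsZariskiLocalAtTarget _
  refine of_chartOpen K n @LocallyQuasiFinite fun k ↦ ?_
  obtain ⟨j, c, hj, -, h⟩ := exists_squareMap_morphismRestrict_eq K k
  have := isFinite_powMap K (d := fun _ : Fin n ↦ 2) fun _ ↦ two_pos
  change _ = j ≫ powMap K _ ≫ c.hom at h
  rw [h]
  infer_instance

lemma surjective_squareMap [NeZero (2 : K)] : Surjective (squareMap K n) := by
  refine of_chartOpen K n @Surjective fun k ↦ ?_
  obtain ⟨j, c, -, hj, h⟩ := exists_squareMap_morphismRestrict_eq K k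
  have hs : Surjective (j ≫ powMap K fun _ ↦ 2) := by
    refine ⟨fun p ↦ ?_⟩
    obtain ⟨q, hq, hq'⟩ := exists_comap_powHom_eq_notMem K p
    obtain ⟨x, rfl⟩ : q ∈ Set.range j := hj ▸ hq'
    exact ⟨x, (Scheme.Hom.comp_apply _ _ _).trans hq⟩
  change _ = j ≫ powMap K _ ≫ c.hom at h
  rw [h, ← Category.assoc]
  infer_instance

lemma nonempty_iso_chartOpen (k : Fin (n + 1)) :
    Nonempty (polySpec K n ≅ (chartOpen K n k).toScheme) :=
  have ⟨_, c, _⟩ := exists_squareMap_morphismRestrict_eq K k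
  ⟨c⟩

lemma mem_chartOpen (x : projectiveSpace K n) : ∃ k, x ∈ chartOpen K n k := by
  have h : x ∈ ⨆ k, chartOpen K n k := by rw [iSup_chartOpen]; trivial
  simpa using h

/-- Irreducibility is inherited from affine space through the surjection `squareMap`; reducedness is
checked on charts. -/
lemma isIntegral_projectiveSpace [NeZero (2 : K)] : IsIntegral (projectiveSpace K n) := by
  have := surjective_squareMap K n
  have : IrreducibleSpace (projectiveSpace K n) :=
    Function.Surjective.irreducibleSpace (squareMap K n).continuous (squareMap K n).surjective
  have (x : projectiveSpace K n) :
      _root_.IsReduced ((projectiveSpace K n).presheaf.stalk x) := by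
    obtain ⟨k, hk⟩ := mem_chartOpen K n x
    obtain ⟨c⟩ := nonempty_iso_chartOpen K n k
    have : IsReduced (chartOpen K n k).toScheme := isReduced_of_isOpenImmersion c.inv
    have : _root_.IsReduced ((chartOpen K n k).toScheme.presheaf.stalk ⟨x, hk⟩) :=
      (inferInstance : ∀ y : (chartOpen K n k).toScheme,
        _root_.IsReduced ((chartOpen K n k).toScheme.presheaf.stalk y)) _
    exact isReduced_of_injective ((chartOpen K n k).stalkIso ⟨x, hk⟩).inv.hom
      (ConcreteCategory.bijective_of_isIso ((chartOpen K n k).stalkIso ⟨x, hk⟩).inv).1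
  have := isReduced_of_isReduced_stalk (projectiveSpace K n)
  exact isIntegral_of_irreducibleSpace_of_isReduced _

lemma topologicalKrullDim_polySpec : topologicalKrullDim (polySpec K n) = n := by
  refine (PrimeSpectrum.topologicalKrullDim_eq_ringKrullDim (MvPolynomial (Fin n) K)).trans ?_
  simp [ringKrullDim_of_isNoetherianRing]

lemma topologicalKrullDim_projectiveSpace : topologicalKrullDim (projectiveSpace K n) = n := by
  let c (k) := (nonempty_iso_chartOpen K n k).some
  let f (k) : polySpec K n ⟶ projectiveSpace K n := (c k).hom ≫ (chartOpen K n k).ι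
  refine le_antisymm ?_ ?_
  · refine topologicalKrullDim_le_of_openCover (fun k ↦ f k) (fun k ↦ (f k).isOpenEmbedding)
      (fun x ↦ ?_) fun k ↦ (topologicalKrullDim_polySpec K n).le
    obtain ⟨k, hk⟩ := mem_chartOpen K n x
    obtain ⟨y, hy⟩ := (c k).hom.surjective ⟨x, hk⟩
    exact ⟨k, y, by simp [f, hy]⟩
  · rw [← topologicalKrullDim_polySpec K n]
    exact (f 0).isOpenEmbedding.isInducing.topologicalKrullDim_le

/-- Open immersions have degree 1, so one chart determines the degree. -/
lemma degree_squareMap [NeZero (2 : K)] : degree (squareMap K n) = 2 ^ n := by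
  obtain ⟨j, c, hj, -, h⟩ := exists_squareMap_morphismRestrict_eq K (0 : Fin (n + 1))
  have := isIntegral_projectiveSpace K n
  have := surjective_squareMap K n
  have := surjective_powMap K (d := fun _ : Fin n ↦ 2) fun _ ↦ two_pos
  generalize chartOpen K n 0 = U at j c h
  have hx : Nonempty (polySpec K n) := inferInstance
  have : Nonempty U := hx.map c.hom
  have : Nonempty (squareMap K n ⁻¹ᵁ U) := by
    obtain ⟨y⟩ := ‹Nonempty U›
    obtain ⟨x, hx⟩ := (squareMap K n).surjective y.1
    exact ⟨⟨x, show squareMap K n x ∈ U from hx ▸ y.2⟩⟩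
  have := isDominant_of_isOpenImmersion (squareMap K n ⁻¹ᵁ U).ι
  have := isDominant_of_isOpenImmersion j
  have : IsDominant (c.hom ≫ U.ι) := isDominant_of_isOpenImmersion _
  have h1 := degree_comp (squareMap K n ⁻¹ᵁ U).ι (squareMap K n)
  rw [← morphismRestrict_ι, h, Category.assoc, Category.assoc,
    degree_of_isOpenImmersion (squareMap K n ⁻¹ᵁ U).ι, mul_one] at h1
  change degree (j ≫ powMap K _ ≫ c.hom ≫ U.ι) = _ at h1
  rw [← h1, degree_comp, degree_comp, degree_of_isOpenImmersion j,
    degree_of_isOpenImmersion (c.hom ≫ U.ι), degree_powMap K fun _ ↦ two_pos]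
  simp

lemma squareMap_over : squareMap K n ≫ projectiveSpace K n ↘ Spec (.of K) =
    Spec.map (CommRingCat.ofHom (C : K →+* MvPolynomial (Fin n) K)) := by
  change squareMap K n ≫ Proj.toSpecZero _ ≫ Spec.map _ = _
  refine (Proj.fromOfGlobalSections_toSpecZero_assoc _ _ _ _).trans ?_
  have h : (CommRingCat.ofHom (algebraMap K (homogeneousSubmodule (Fin (n + 1)) K 0))) ≫
      CommRingCat.ofHom ((squareHom (polyEquivΓ K n)).comp
        (algebraMap (homogeneousSubmodule (Fin (n + 1)) K 0) (MvPolynomial (Fin (n + 1)) K))) =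
      CommRingCat.ofHom (C : K →+* MvPolynomial (Fin n) K) ≫ (Scheme.ΓSpecIso _).inv := by
    ext r
    exact squareHom_C (polyEquivΓ K n) r
  rw [← Spec.map_comp, h, Spec.map_comp]
  exact toSpecΓ_SpecMap_ΓSpecIso_inv_assoc _ _

end SquareMapProperties

/-! ### The pseudo-charts and their degrees -/

/-- Affine space is the spectrum of the polynomial ring. -/
def affineSpaceIso (K : Type u) [Field K] (n : ℕ) : affineSpace K n ≅ polySpec K n :=
  AffineSpace.SpecIso (ULift.{u} (Fin n)) (.of K) ≪≫
    Scheme.Spec.mapIso (renameEquiv K Equiv.ulift.symm).toCommRingCatIso.op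

lemma affineSpaceIso_hom_over (K : Type u) [Field K] (n : ℕ) :
    (affineSpaceIso K n).hom ≫ Spec.map (CommRingCat.ofHom (C : K →+* MvPolynomial (Fin n) K)) =
      affineSpace K n ↘ Spec (.of K) := by
  have h : CommRingCat.ofHom (C : K →+* MvPolynomial (Fin n) K) ≫
      (renameEquiv K (Equiv.ulift.{u} (α := Fin n)).symm).toCommRingCatIso.hom =
      CommRingCat.ofHom C := by
    ext r : 2
    exact rename_C _ r
  have h' : (affineSpaceIso K n).hom = (AffineSpace.SpecIso (ULift.{u} (Fin n)) (.of K)).hom ≫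
      Spec.map (renameEquiv K (Equiv.ulift.{u} (α := Fin n)).symm).toCommRingCatIso.hom := rfl
  rw [h', Category.assoc, ← Spec.map_comp, h, ← Iso.eq_inv_comp]
  exact (AffineSpace.SpecIso_inv_over _).symm

/-- The pseudo-chart `t ↦ [x₀² : … : xₙ²]`, where `x₀, …, xₙ` are the coordinates adding up to `1`
with `xᵢ = tᵢ ^ dᵢ` for `i > 0`. -/
def powSquareMap (K : Type u) [Field K] {n : ℕ} (d : Fin n → ℕ) :
    affineSpace K n ⟶ projectiveSpace K n :=
  (affineSpaceIso K n).hom ≫ powMap K d ≫ squareMap K n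

section PowSquareMap

variable (K : Type u) [Field K] {n : ℕ} {d : Fin n → ℕ}

lemma powSquareMap_isOver : (powSquareMap K d).IsOver (Spec (.of K)) := by
  refine ⟨?_⟩
  rw [← affineSpaceIso_hom_over, powSquareMap, Category.assoc, Category.assoc, squareMap_over,
    powMap, ← Spec.map_comp]
  congr 3
  ext : 2
  simp

lemma flat_powSquareMap (hd : ∀ i, 0 < d i) : Flat (powSquareMap K d) := by
  have := flat_powMap K hd
  have := flat_squareMap K n
  unfold powSquareMap
  infer_instance

lemma hasFiniteFibers_powSquareMap (hd : ∀ i, 0 < d i) : HasFiniteFibers (powSquareMap K d) := by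
  have := isFinite_powMap K hd
  have := locallyQuasiFinite_squareMap K n
  unfold powSquareMap
  exact fun y ↦ Scheme.Hom.finite_preimage_singleton _ y

variable [NeZero (2 : K)]

lemma surjective_powSquareMap (hd : ∀ i, 0 < d i) : Surjective (powSquareMap K d) := by
  have := surjective_powMap K hd
  have := surjective_squareMap K n
  unfold powSquareMap
  infer_instance

lemma degree_powSquareMap (hd : ∀ i, 0 < d i) :
    degree (powSquareMap K d) = 2 ^ n * ∏ i, d i := by
  have := isIntegral_projectiveSpace K n
  have := surjective_powMap K hd
  have := surjective_squareMap K n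
  unfold powSquareMap
  rw [degree_comp, degree_comp, degree_squareMap, degree_powMap K hd, degree_of_isOpenImmersion,
    mul_one]

lemma isPseudoChart_powSquareMap (hd : ∀ i, 0 < d i) : IsPseudoChart (powSquareMap K d) where
  isIntegral := isIntegral_projectiveSpace K n
  dim_eq := topologicalKrullDim_projectiveSpace K n
  isOver := powSquareMap_isOver K
  dim_range := by
    have := surjective_powSquareMap K hd
    rw [(powSquareMap K d).surjective.range_eq, ← topologicalKrullDim_projectiveSpace K n]
    exact (Homeomorph.Set.univ _).isHomeomorph.topologicalKrullDim_eq

variable (n) in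
lemma exists_isPseudoChart (hn : 0 < n) {m : ℕ} (hm : 0 < m) :
    ∃ f : affineSpace K n ⟶ projectiveSpace K n,
      IsPseudoChart f ∧ Surjective f ∧ Flat f ∧ HasFiniteFibers f ∧ degree f = 2 ^ n * m := by
  -- One coordinate carries the whole factor `m`; the other exponents are 1.
  let d : Fin n → ℕ := Function.update 1 ⟨0, hn⟩ m
  have hd (i) : 0 < d i := by
    by_cases h : i = ⟨0, hn⟩ <;> simp [d, h, hm]
  refine ⟨powSquareMap K d, isPseudoChart_powSquareMap K hd, surjective_powSquareMap K hd,
    flat_powSquareMap K hd, hasFiniteFibers_powSquareMap K hd, ?_⟩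
  rw [degree_powSquareMap K hd, Finset.prod_update_of_mem (Finset.mem_univ _)]
  simp

end PowSquareMap

end PseudoChart

end

theorem proposition2p7 {K : Type u} [Field K] [IsAlgClosed K] [CharZero K] (n : ℕ) (hn : 1 ≤ n) :
    (∃ f : PseudoChart.affineSpace K n ⟶ PseudoChart.projectiveSpace K n,
      PseudoChart.IsPseudoChart f ∧ Surjective f ∧ Flat f ∧ PseudoChart.HasFiniteFibers f ∧
        PseudoChart.degree f = n.factorial * 2 ^ n) ∧
    (2 ≤ n → ∃ f : PseudoChart.affineSpace K n ⟶ PseudoChart.projectiveSpace K n,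
      PseudoChart.IsPseudoChart f ∧ Surjective f ∧ Flat f ∧ PseudoChart.HasFiniteFibers f ∧
        PseudoChart.degree f = n.factorial * 2 ^ (n - 1)) := by
  refine ⟨mul_comm (2 ^ n) n.factorial ▸
    PseudoChart.exists_isPseudoChart K n hn n.factorial_pos, fun h2 ↦ ?_⟩
  -- For `2 ≤ n` the factorial is even, so `m = n! / 2` is an admissible exponent.
  obtain ⟨m, hm⟩ : 2 ∣ n.factorial := Nat.dvd_factorial two_pos h2
  have hm0 : 0 < m := Nat.pos_of_ne_zero fun h ↦ n.factorial_ne_zero (by simp [hm, h])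
  have h : n.factorial * 2 ^ (n - 1) = 2 ^ n * m := by
    rw [hm, mul_right_comm, ← pow_succ', Nat.sub_add_cancel hn]
  rw [h]
  exact PseudoChart.exists_isPseudoChart K n hn hm0
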